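/- A network is a connected undirected graph with $N\ge 2$ nodes and symmetric edge weights $a_{ij}=a_{ji}$, positive on edges and zero elsewhere; its Laplacian $L=D-A$, where $D=\mathrm{diag}\big(\sum_j a_{ij}\big)$, has eigenvalues $0=\lambda_1<\lambda_2\le\dots\le\lambda_N$. For $0<\alpha\le\beta$ let $\mathcal G_{[\alpha,\beta]}$ be the class of all networks whose nonzero Laplacian eigenvalues lie in $[\alpha,\beta]$ (the number of nodes $N\ge2$ being either arbitrary or prescribed). For $M\ge 1$ consider $x_i(k+1)=x_i(k)+u_i(k)$, $k\ge0$, with $$u_i(k)=\sum_{m=0}^M\varepsilon_m\sum_{j}a_{ij}\big(x_j(k-m)-x_i(k-m)\big)+\sum_{m=0}^M\theta_m x_i(k-m),$$ where $\varepsilon_m\ge 0$, $\theta_m\in\mathbb R$, and $x_i(-M)=\dots=x_i(-1)=x_i(0)$. Average consensus is reached on a network if $\lim_{k\to\infty}x_i(k)=\frac1N\sum_j x_j(0)$ for every $i$ and every initial state. Let $\Gamma(\lambda)$ be the $(M+1)\times(M+1)$ companion matrix with first row $(1+\theta_0-\varepsilon_0\lambda,\ \theta_1-\varepsilon_1\lambda,\dots,\theta_M-\varepsilon_M\lambda)$,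 ones on the subdiagonal and zeros elsewhere, let $r_M=\max_{2\le i\le N}\rho(\Gamma(\lambda_i))$, where $\rho$ is the spectral radius, be the convergence rate on a network, and let $\gamma_M=\sup_{\mathcal G\in\mathcal G_{[\alpha,\beta]}}r_M$ be the worst-case convergence rate. Let $\gamma_M^*$ be the infimum of $\gamma_M$ over all parameters $\varepsilon_m\ge0$, $\theta_m\in\mathbb R$ for which average consensus is reached on every network of $\mathcal G_{[\alpha,\beta]}$. **Theorem.** For every $M\ge1$, $$\gamma_M^*=\frac{\sqrt\beta-\sqrt\alpha}{\sqrt\beta+\sqrt\alpha}.$$ The infimum is attained by the one-tap node-memory parameters $$\varepsilon_0=\frac{4}{(\sqrt\beta+\sqrt\alpha)^2},\qquad \theta_0=\Big(\frac{\sqrt\beta-\sqrt\alpha}{\sqrt\beta+\sqrt\alpha}\Big)^2,\qquad \theta_1=-\theta_0,$$ with all other $\varepsilon_m,\theta_m$ equal to $0$; with these, average consensus is reached on every network of the class. Moreover $\gamma_M\ge\frac{\sqrt\beta-\sqrt\alpha}{\sqrt\beta+\sqrt\alpha}$ for all real $\varepsilon_m$ (of any sign) and real $\theta_m$ with $\sum_{m=0}^M\theta_m=0$.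 In particular $\gamma_M^*=\gamma_1^*$: neither more than one tap of memory nor any state-deviation memory ($\varepsilon_m\neq0$ with $m\ge1$) improves the worst case. -/

import Mathlib

open Filter Topology
open scoped ENNReal

noncomputable section

/-- A connected undirected weighted network with `N ≥ 2` agents: an edge set together with a
symmetric weight matrix that is positive exactly on the edges. -/
structure Network where
  /-- number of agents -/
  N : ℕ
  two_le : 2 ≤ N
  /-- edge set -/
  graph : SimpleGraph (Fin N)
  /-- weighted adjacency matrix -/
  weight : Matrix (Fin N) (Fin N) ℝ
  weight_symm : ∀ i j, weight i j = weight j i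
  weight_pos : ∀ i j, graph.Adj i j → 0 < weight i j
  weight_zero : ∀ i j, ¬ graph.Adj i j → weight i j = 0
  connected : graph.Connected

namespace Network

/-- The Laplacian `L = D - A`. -/
def laplacian (G : Network) : Matrix (Fin G.N) (Fin G.N) ℝ :=
  Matrix.diagonal (fun i => ∑ j, G.weight i j) - G.weight

theorem laplacian_isHermitian (G : Network) : G.laplacian.IsHermitian := by
  ext i j
  rcases eq_or_ne i j with h | h
  · subst h; simp [laplacian]
  · simp [laplacian, Matrix.diagonal_apply_ne _ h, Matrix.diagonal_apply_ne _ h.symm,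
      G.weight_symm i j]

/-- The Laplacian eigenvalues, with multiplicity, in ascending order: `G.eig i` for
`i = 0, …, N - 1` are `λ₁ ≤ λ₂ ≤ ⋯ ≤ λ_N` (Mathlib's `eigenvalues₀` is in descending order). -/
def eig (G : Network) (i : Fin G.N) : ℝ :=
  G.laplacian_isHermitian.eigenvalues₀ (Fin.cast (Fintype.card_fin G.N).symm i.rev)

end Network

/-- The uncertain network class `𝒢_[α,β]`: all (connected) networks whose nonzero Laplacian
eigenvalues all lie in `[α, β]`. -/
def uncertainNetworks (α β : ℝ) : Set Network :=
  {G | ∀ i, G.eig i ≠ 0 → G.eig i ∈ Set.Icc α β}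

/-- Control parameters of a protocol with memory length `M`: state deviation gains
`ε₀, …, ε_M` and node gains `θ₀, …, θ_M`. -/
structure Params (M : ℕ) where
  ε : Fin (M + 1) → ℝ
  θ : Fin (M + 1) → ℝ

namespace Params

variable {M : ℕ}

/-- The control input `u_i(k)`; the sum over the neighbours of `i` is written over all agents,
as `a_ij = 0` for non-neighbours. -/
def control (p : Params M) (G : Network) (x : ℤ → Fin G.N → ℝ) (k : ℤ) (i : Fin G.N) : ℝ :=
  ∑ m : Fin (M + 1), p.ε m * ∑ j, G.weight i j * (x (k - (m : ℕ)) j - x (k - (m : ℕ)) i)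
    + ∑ m : Fin (M + 1), p.θ m * x (k - (m : ℕ)) i

/-- `x` is a trajectory of `x_i(k+1) = x_i(k) + u_i(k)`, `k ≥ 0`, under the protocol `p` with
initial states `x_i(-M) = ⋯ = x_i(-1) = x_i(0)`. -/
def IsTrajectory (p : Params M) (G : Network) (x : ℤ → Fin G.N → ℝ) : Prop :=
  (∀ k : ℤ, -(M : ℤ) ≤ k → k ≤ 0 → x k = x 0) ∧
    ∀ k : ℤ, 0 ≤ k → ∀ i, x (k + 1) i = x k i + p.control G x k i

/-- Average consensus is reached asymptotically on `G`, for any initial state. -/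
def ReachesConsensus (p : Params M) (G : Network) : Prop :=
  ∀ x : ℤ → Fin G.N → ℝ, p.IsTrajectory G x →
    ∀ i, Tendsto (fun k : ℕ => x (k : ℤ) i) atTop (𝓝 ((1 / (G.N : ℝ)) * ∑ j, x 0 j))

/-- The companion matrix `Γ(λ)` of size `M + 1`: first row
`(1 + θ₀ - ε₀ λ, θ₁ - ε₁ λ, …, θ_M - ε_M λ)`, ones on the subdiagonal, zeros elsewhere. -/
def Γ (p : Params M) (l : ℝ) : Matrix (Fin (M + 1)) (Fin (M + 1)) ℝ :=
  Matrix.of fun i j =>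
    if i = 0 then (if j = 0 then 1 else 0) + p.θ j - p.ε j * l
    else if (i : ℕ) = (j : ℕ) + 1 then 1 else 0

/-- The spectral radius `ρ(Γ(λ))`, the largest modulus of a complex eigenvalue. -/
def rho (p : Params M) (l : ℝ) : ℝ≥0∞ :=
  spectralRadius ℂ ((p.Γ l).map Complex.ofReal)

/-- The convergence rate `r_M = max_{i = 2, …, N} ρ(Γ(λ_i))` on a network
(index `0` stands for `λ₁`). -/
def rate (p : Params M) (G : Network) : ℝ≥0∞ :=
  ⨆ (i : Fin G.N) (_ : 0 < (i : ℕ)), p.rho (G.eig i)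

/-- The worst-case convergence rate `γ_M = sup_{G ∈ 𝒢} r_M`. -/
def worstCaseRate (p : Params M) (𝒢 : Set Network) : ℝ≥0∞ :=
  ⨆ G ∈ 𝒢, p.rate G

/-- Admissible parameters: nonnegative gains `ε_m` and arbitrary real `θ_m` such that consensus
is reached on every network of the class. -/
def Admissible (p : Params M) (𝒢 : Set Network) : Prop :=
  (∀ m, 0 ≤ p.ε m) ∧ ∀ G ∈ 𝒢, p.ReachesConsensus G

end Params

/-- The optimal worst-case convergence rate `γ_M^*`. -/
def optimalWorstCaseRate (M : ℕ) (𝒢 : Set Network) : ℝ≥0∞ :=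
  ⨅ (p : Params M) (_ : p.Admissible 𝒢), p.worstCaseRate 𝒢

/-- The one-tap node-memory parameters: `ε₀ = 4 / (√β + √α)²`,
`θ₀ = ((√β - √α) / (√β + √α))²`, `θ₁ = -θ₀`, and all other gains zero. -/
def oneTapParams (α β : ℝ) (M : ℕ) : Params M where
  ε m := if (m : ℕ) = 0 then 4 / (√β + √α) ^ 2 else 0
  θ m :=
    if (m : ℕ) = 0 then ((√β - √α) / (√β + √α)) ^ 2
    else if (m : ℕ) = 1 then -((√β - √α) / (√β + √α)) ^ 2
    else 0

end

/-!
Write `τ = (√β - √α) / (√β + √α)`. The class contains, for each `l ∈ [α, β]`, the complete graph with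
all weights `l / N`, whose only nonzero Laplacian eigenvalue is `l`; and on a connected network `0` is
a simple eigenvalue. So the worst-case rate is governed by the spectral radius of `Γ(l)` as `l` runs
through `[α, β]`, whatever the number of agents.

*Lower bound* (`Params.le_of_forall_rho_le`). Let `a_l(w) = det (1 - w Γ(l))` be the reversed
characteristic polynomial, which is affine in `l`. If all `Γ(l)` have spectral radius at most
`r < 1`, no `a_l` with `l ∈ [α, β]` vanishes on the disk `|w| < 1 / r`, and then convexity of
`[α, β]` shows that `a_α / a_β` avoids `(-∞, 0]` there. Hence `g = √(a_α / a_β)` is holomorphic on this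
disk with positive real part, and `h = (1 - g) / (1 + g)` maps it to the unit disk. Here `h(0) = 0`,
while `∑ θ_m = 0` gives `a_l(1) = l ∑ ε_m`, so that `h(1) = τ`. Schwarz's lemma at `w = 1` yields
`τ ≤ r`. The condition `∑ θ_m = 0` is forced by consensus, as one sees from the all-ones initial
state (`Params.sum_θ_eq_zero_of_reachesConsensus`).

*Attainment.* For the one-tap parameters, the nonzero eigenvalues of `Γ(l)` are zeros of
`z² - (1 + τ² - ε₀ l) z + τ²`, whose discriminant is nonpositive exactly for `l ∈ [α, β]`; so they have
modulus `τ` (`Params.rho_oneTapParams_le`). Consensus follows by decomposing a trajectory along an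
eigenbasis of the Laplacian: modes with nonzero eigenvalue decay, the limit is therefore in the
kernel of the Laplacian, that is constant, and the sum of the states is conserved
(`Network.tendsto_average`).
-/

/-! ### Spectral radius of the companion matrix -/

theorem Matrix.mem_spectrum_iff_exists_mulVec {K n : Type*} [Field K] [Fintype n] [DecidableEq n]
    (A : Matrix n n K) (μ : K) : μ ∈ spectrum K A ↔ ∃ v ≠ 0, A.mulVec v = μ • v := by
  rw [← Matrix.spectrum_toLin', ← Module.End.hasEigenvalue_iff_mem_spectrum]
  constructor
  · intro h
    obtain ⟨v, hv⟩ := h.exists_hasEigenvector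
    exact ⟨v, hv.2, by simpa using hv.apply_eq_smul⟩
  · rintro ⟨v, hv, h⟩
    exact Module.End.hasEigenvalue_of_hasEigenvector (x := v)
      ⟨Module.End.mem_eigenspace_iff.2 (by simpa using h), hv⟩

namespace Params

variable {M : ℕ}

/-- The reversed characteristic polynomial `det (1 - w Γ(l))` of the companion matrix, evaluated
at `w : ℂ`. It is `1` at `w = 0`, so working with it in place of the characteristic polynomial
moves the point at infinity of the `z`-plane, `z = 1 / w`, to the origin. -/
noncomputable def revChar (p : Params M) (l : ℝ) (w : ℂ) : ℂ :=
  1 - w * ∑ j : Fin (M + 1),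
    (((if j = 0 then 1 else 0) + p.θ j - p.ε j * l : ℝ) : ℂ) * w ^ (j : ℕ)

theorem Γ_mulVec_zero (p : Params M) (l : ℝ) (v : Fin (M + 1) → ℂ) :
    ((p.Γ l).map Complex.ofReal).mulVec v 0 =
      ∑ j, (((if j = 0 then 1 else 0) + p.θ j - p.ε j * l : ℝ) : ℂ) * v j := by
  simp [Matrix.mulVec, dotProduct, Γ]

theorem Γ_mulVec_succ (p : Params M) (l : ℝ) (v : Fin (M + 1) → ℂ) (i : Fin M) :
    ((p.Γ l).map Complex.ofReal).mulVec v i.succ = v i.castSucc := by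
  simp only [Matrix.mulVec, dotProduct, Γ, Matrix.map_apply, Matrix.of_apply]
  rw [Finset.sum_eq_single i.castSucc]
  · simp
  · intro j _ hj
    have : ¬ (i : ℕ) = (j : ℕ) := fun h => hj (Fin.ext h.symm)
    simp [this, Fin.succ_ne_zero]
  · simp

/-- A zero `w` of the reversed characteristic polynomial gives the eigenvalue `1 / w`, with
eigenvector `(1, w, …, w ^ M)`. -/
theorem inv_mem_spectrum_of_revChar_eq_zero (p : Params M) (l : ℝ) {w : ℂ}
    (h : p.revChar l w = 0) : w⁻¹ ∈ spectrum ℂ ((p.Γ l).map Complex.ofReal) := by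
  have hw : w ≠ 0 := by
    rintro rfl
    simp [revChar] at h
  rw [Matrix.mem_spectrum_iff_exists_mulVec]
  refine ⟨fun j => w ^ (j : ℕ), fun h0 => by simpa using congrFun h0 0, ?_⟩
  ext i
  refine Fin.cases ?_ (fun i => ?_) i
  · rw [Γ_mulVec_zero]
    simp only [Pi.smul_apply, Fin.val_zero, pow_zero, smul_eq_mul, mul_one]
    rw [revChar, sub_eq_zero] at h
    exact eq_inv_of_mul_eq_one_right h.symm
  · rw [Γ_mulVec_succ]
    simp only [Fin.val_castSucc, Pi.smul_apply, Fin.val_succ, smul_eq_mul, pow_succ]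
    field_simp

theorem revChar_ne_zero_of_rho_le (p : Params M) {l r : ℝ} (hr : 0 < r)
    (h : p.rho l ≤ ENNReal.ofReal r) {w : ℂ} (hw : ‖w‖ < r⁻¹) : p.revChar l w ≠ 0 := by
  intro h0
  have hw0 : w ≠ 0 := by
    rintro rfl
    simp [revChar] at h0
  have h1 : ENNReal.ofReal ‖w⁻¹‖ ≤ ENNReal.ofReal r := by
    rw [ofReal_norm]
    exact (le_iSup₂ (f := fun (k : ℂ) (_ : k ∈ spectrum ℂ ((p.Γ l).map Complex.ofReal)) =>
      (‖k‖₊ : ℝ≥0∞)) _ (p.inv_mem_spectrum_of_revChar_eq_zero l h0)).trans h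
  rw [ENNReal.ofReal_le_ofReal_iff hr.le, norm_inv] at h1
  have := (lt_inv_comm₀ (norm_pos_iff.2 hw0) hr).1 hw
  linarith

theorem revChar_at_zero (p : Params M) (l : ℝ) : p.revChar l 0 = 1 := by simp [revChar]

theorem revChar_one (p : Params M) (hθ : ∑ m, p.θ m = 0) (l : ℝ) :
    p.revChar l 1 = ((l * ∑ m, p.ε m : ℝ) : ℂ) := by
  have h : ∑ j : Fin (M + 1), ((if j = 0 then 1 else 0) + p.θ j - p.ε j * l)
      = 1 - l * ∑ m, p.ε m := by
    rw [Finset.sum_sub_distrib, Finset.sum_add_distrib, hθ, ← Finset.sum_mul]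
    simp [mul_comm]
  simp only [revChar, one_pow, mul_one, one_mul]
  rw [← Complex.ofReal_sum, h]
  push_cast
  ring

/-- The reversed characteristic polynomial is affine in `l`. -/
theorem revChar_convex_comb (p : Params M) (a b s t : ℝ) (hst : s + t = 1) (w : ℂ) :
    p.revChar (s * a + t * b) w = s * p.revChar a w + t * p.revChar b w := by
  have hst' : (s : ℂ) + t = 1 := by exact_mod_cast hst
  have key : ∀ l : ℝ, p.revChar l w = (1 - w * ∑ j : Fin (M + 1),
      (((if j = 0 then 1 else 0) + p.θ j : ℝ) : ℂ) * w ^ (j : ℕ))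
        + l * (w * ∑ j : Fin (M + 1), (p.ε j : ℂ) * w ^ (j : ℕ)) := by
    intro l
    have h : ∑ j : Fin (M + 1),
        (((if j = 0 then 1 else 0) + p.θ j - p.ε j * l : ℝ) : ℂ) * w ^ (j : ℕ)
        = ∑ j : Fin (M + 1), (((if j = 0 then 1 else 0) + p.θ j : ℝ) : ℂ) * w ^ (j : ℕ)
          - l * ∑ j : Fin (M + 1), (p.ε j : ℂ) * w ^ (j : ℕ) := by
      rw [Finset.mul_sum, ← Finset.sum_sub_distrib]
      refine Finset.sum_congr rfl fun j _ => ?_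
      push_cast
      ring
    rw [revChar, h]
    ring
  rw [key, key a, key b]
  generalize 1 - w * ∑ j : Fin (M + 1),
      (((if j = 0 then 1 else 0) + p.θ j : ℝ) : ℂ) * w ^ (j : ℕ) = A
  push_cast
  linear_combination -A * hst'

theorem differentiable_revChar (p : Params M) (l : ℝ) : Differentiable ℂ (p.revChar l) := by
  unfold revChar
  fun_prop

/-- If `revChar l w` vanishes for no `l ∈ [α, β]`, then `revChar α w / revChar β w` avoids the
closed negative half-line, where the principal square root is not holomorphic. -/
theorem revChar_div_mem_slitPlane (p : Params M) {α β : ℝ} (hαβ : α ≤ β) {w : ℂ}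
    (h : ∀ l ∈ Set.Icc α β, p.revChar l w ≠ 0) :
    p.revChar α w / p.revChar β w ∈ Complex.slitPlane := by
  rw [Complex.mem_slitPlane_iff_not_le_zero]
  intro hle
  obtain ⟨hre, him⟩ := Complex.nonpos_iff.1 hle
  set t : ℝ := -(p.revChar α w / p.revChar β w).re with ht
  have ht0 : 0 ≤ t := by linarith
  have hq : p.revChar α w / p.revChar β w = -(t : ℂ) := by
    apply Complex.ext <;> simp [ht, him]
  have hb := h β ⟨hαβ, le_rfl⟩
  rw [div_eq_iff hb] at hq
  -- `revChar α w + t * revChar β w = 0` is a zero at the convex combination `(α + tβ) / (1 + t)`.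
  have hs : (1 + t)⁻¹ + t * (1 + t)⁻¹ = 1 := by
    rw [← one_add_mul]
    exact mul_inv_cancel₀ (by positivity)
  refine h ((1 + t)⁻¹ * α + t * (1 + t)⁻¹ * β) ?_ ?_
  · exact (convex_Icc α β) ⟨le_rfl, hαβ⟩ ⟨hαβ, le_rfl⟩ (by positivity) (by positivity) hs
  · rw [p.revChar_convex_comb _ _ _ _ hs, hq]
    push_cast
    ring

/-- If all `Γ(l)` with `l ∈ [α, β]` have spectral radius at most `r < 1`, then `r` is at least
`(√β - √α) / (√β + √α)`: Schwarz's lemma, on the disk of radius `1 / r`, for the Cayley transform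
of `√(revChar α / revChar β)`. -/
theorem le_of_forall_rho_le (p : Params M) (hθ : ∑ m, p.θ m = 0) {α β r : ℝ} (hα : 0 < α)
    (hαβ : α ≤ β) (hr0 : 0 < r) (hr1 : r < 1)
    (h : ∀ l ∈ Set.Icc α β, p.rho l ≤ ENNReal.ofReal r) :
    (√β - √α) / (√β + √α) ≤ r := by
  have hβ : 0 < β := hα.trans_le hαβ
  have hne : ∀ w ∈ Metric.ball (0 : ℂ) r⁻¹, ∀ l ∈ Set.Icc α β, p.revChar l w ≠ 0 :=
    fun w hw l hl => p.revChar_ne_zero_of_rho_le hr0 (h l hl) (by simpa using hw)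
  set g : ℂ → ℂ := fun w => (p.revChar α w / p.revChar β w) ^ (1 / 2 : ℂ) with hg
  have hgd : DifferentiableOn ℂ g (Metric.ball 0 r⁻¹) := by
    refine DifferentiableOn.cpow ?_ (differentiableOn_const _)
      fun w hw => p.revChar_div_mem_slitPlane hαβ (hne w hw)
    exact (p.differentiable_revChar α).differentiableOn.div
      (p.differentiable_revChar β).differentiableOn fun w hw => hne w hw β ⟨hαβ, le_rfl⟩
  have hgre : ∀ w ∈ Metric.ball (0 : ℂ) r⁻¹, 0 < (g w).re := by
    intro w hw
    have hs := p.revChar_div_mem_slitPlane hαβ (hne w hw)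
    have h0 := Complex.slitPlane_ne_zero hs
    have harg := (Complex.mem_slitPlane_iff_arg.1 hs).1
    simp only [hg]
    rw [Complex.cpow_def_of_ne_zero h0, Complex.exp_re]
    refine mul_pos (Real.exp_pos _) (Real.cos_pos_of_mem_Ioo ?_)
    have him : (Complex.log (p.revChar α w / p.revChar β w) * (1 / 2)).im
        = (p.revChar α w / p.revChar β w).arg / 2 := by
      rw [show (1 / 2 : ℂ) = ((1 / 2 : ℝ) : ℂ) by push_cast; rfl, Complex.im_mul_ofReal,
        Complex.log_im]
      ring
    rw [him]
    have h1 := Complex.neg_pi_lt_arg (p.revChar α w / p.revChar β w)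
    have h2 := (Complex.arg_le_pi (p.revChar α w / p.revChar β w)).lt_of_ne harg
    constructor <;> linarith
  have hden : ∀ w ∈ Metric.ball (0 : ℂ) r⁻¹, 1 + g w ≠ 0 := by
    intro w hw h0
    have := congrArg Complex.re h0
    simp at this
    linarith [hgre w hw]
  have hmaps : Set.MapsTo (fun w => (1 - g w) / (1 + g w)) (Metric.ball 0 r⁻¹)
      (Metric.ball ((1 - g 0) / (1 + g 0)) 1) := by
    intro w hw
    have hg0 : g 0 = 1 := by simp [hg, revChar_at_zero]
    rw [hg0, sub_self, zero_div, mem_ball_zero_iff, norm_div,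
      div_lt_one (norm_pos_iff.2 (hden w hw))]
    rw [← sq_lt_sq₀ (norm_nonneg _) (norm_nonneg _), ← Complex.normSq_eq_norm_sq,
      ← Complex.normSq_eq_norm_sq, Complex.normSq_apply, Complex.normSq_apply]
    simp
    nlinarith [hgre w hw]
  have hone : (1 : ℂ) ∈ Metric.ball (0 : ℂ) r⁻¹ := by
    simpa using (one_lt_inv₀ hr0).2 hr1
  have hS := Complex.dist_le_div_mul_dist_of_mapsTo_ball
    (((differentiableOn_const (1 : ℂ)).sub hgd).div ((differentiableOn_const (1 : ℂ)).add hgd) hden)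
    (hmaps.mono_right Metric.ball_subset_closedBall) hone
  have hg0 : g 0 = 1 := by simp [hg, revChar_at_zero]
  have hg1 : g 1 = ((√α / √β : ℝ) : ℂ) := by
    have hσ : ∑ m, p.ε m ≠ 0 := by
      intro h0
      apply hne 1 hone α ⟨le_rfl, hαβ⟩
      rw [p.revChar_one hθ, h0]
      simp
    simp only [hg]
    rw [p.revChar_one hθ, p.revChar_one hθ, ← Complex.ofReal_div, mul_div_mul_right _ _ hσ,
      show (1 / 2 : ℂ) = ((1 / 2 : ℝ) : ℂ) by push_cast; rfl,
      ← Complex.ofReal_cpow (by positivity), ← Real.sqrt_eq_rpow, Real.sqrt_div hα.le]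
  have hsα := Real.sqrt_pos.2 hα
  have hsβ := Real.sqrt_pos.2 hβ
  have hval : (1 - ((√α / √β : ℝ) : ℂ)) / (1 + ((√α / √β : ℝ) : ℂ))
      = (((√β - √α) / (√β + √α) : ℝ) : ℂ) := by
    rw [← Complex.ofReal_one, ← Complex.ofReal_sub, ← Complex.ofReal_add, ← Complex.ofReal_div]
    congr 1
    field_simp
  simp only [Pi.div_apply, Pi.sub_apply, Pi.add_apply, hg0, hg1, sub_self, zero_div,
    dist_zero_right, norm_one, mul_one, one_div, inv_inv, hval, Complex.norm_real] at hS
  exact (le_abs_self _).trans hS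

theorem le_iSup_rho (p : Params M) (hθ : ∑ m, p.θ m = 0) {α β : ℝ} (hα : 0 < α)
    (hαβ : α ≤ β) :
    ENNReal.ofReal ((√β - √α) / (√β + √α)) ≤ ⨆ l ∈ Set.Icc α β, p.rho l := by
  by_contra! hlt
  obtain ⟨r, hr0, hr1, hr2⟩ := ENNReal.lt_iff_exists_real_btwn.1 hlt
  have hr2' := (ENNReal.ofReal_lt_ofReal_iff_of_nonneg hr0).1 hr2
  have hsα := Real.sqrt_pos.2 hα
  have hsβ := Real.sqrt_pos.2 (hα.trans_le hαβ)
  have hτ1 : (√β - √α) / (√β + √α) < 1 := by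
    rw [div_lt_one (by positivity)]
    linarith
  have hr : 0 < r := ENNReal.ofReal_pos.1 (bot_le.trans_lt hr1)
  have := p.le_of_forall_rho_le hθ hα hαβ hr (hr2'.trans hτ1)
    fun l hl => (le_iSup₂ (f := fun l (_ : l ∈ Set.Icc α β) => p.rho l) l hl).trans hr1.le
  linarith

end Params

/-- The real quadratic `z² - b z + τ²` with nonpositive discriminant has its zeros in the closed
disk of radius `τ`. -/
theorem Complex.norm_le_of_sq_sub_mul_add_sq_eq_zero {b τ : ℝ} (hτ : 0 ≤ τ) (hb : |b| ≤ 2 * τ)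
    {z : ℂ} (hz : z ^ 2 - b * z + (τ : ℂ) ^ 2 = 0) : ‖z‖ ≤ τ := by
  have hre := congrArg Complex.re hz
  have him := congrArg Complex.im hz
  simp [pow_two] at hre him
  have hb2 : b ^ 2 ≤ (2 * τ) ^ 2 := sq_le_sq' (abs_le.1 hb).1 (abs_le.1 hb).2
  rw [← sq_le_sq₀ (norm_nonneg _) hτ, ← Complex.normSq_eq_norm_sq, Complex.normSq_apply]
  rcases eq_or_ne z.im 0 with h | h
  · have h1 : (z.re - b / 2) ^ 2 ≤ 0 := by
      rw [h] at hre
      nlinarith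
    have h2 : z.re = b / 2 := by
      have := pow_eq_zero_iff (two_ne_zero) |>.1 (le_antisymm h1 (sq_nonneg _))
      linarith
    rw [h, h2]
    nlinarith
  · have h2 : b = 2 * z.re := by
      apply mul_right_cancel₀ h
      linarith
    rw [h2] at hre
    nlinarith

namespace Params

/-- If the first row of `Γ(l)` is `(b, -τ², 0, …, 0)` with `|b| ≤ 2 τ`, then `Γ(l)` has spectral radius at most `τ`. -/
theorem rho_le_of_two_term {M : ℕ} (hM : 1 ≤ M) (p : Params M) {l b τ : ℝ} (hτ : 0 ≤ τ)
    (hb : |b| ≤ 2 * τ)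
    (h : ∀ j : Fin (M + 1), (if j = 0 then 1 else 0) + p.θ j - p.ε j * l
      = if (j : ℕ) = 0 then b else if (j : ℕ) = 1 then -τ ^ 2 else 0) :
    p.rho l ≤ ENNReal.ofReal τ := by
  refine iSup₂_le fun z hz => ?_
  obtain ⟨v, hv, hΓ⟩ := (Matrix.mem_spectrum_iff_exists_mulVec _ _).1 hz
  rw [← enorm_eq_nnnorm, ← ofReal_norm]
  refine ENNReal.ofReal_le_ofReal ?_
  rcases eq_or_ne z 0 with rfl | hz0
  · simpa using hτ
  have hs : ∀ i : Fin M, v i.castSucc = z * v i.succ := fun i => by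
    rw [← p.Γ_mulVec_succ l v i, hΓ]
    rfl
  obtain ⟨K, rfl⟩ : ∃ K, M = K + 1 := ⟨M - 1, by omega⟩
  have h0 : z * v 0 = b * v 0 - (τ : ℂ) ^ 2 * v 1 := by
    have := congrFun hΓ 0
    rw [Γ_mulVec_zero] at this
    simp only [h] at this
    rw [Fin.sum_univ_succ, Fin.sum_univ_succ] at this
    simp at this
    rw [← this]
    ring
  have h1 : v 0 = z * v 1 := hs 0
  have hv1 : v 1 ≠ 0 := by
    intro h10
    apply hv
    ext i
    induction i using Fin.induction with
    | zero => rw [h1, h10]; simp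
    | succ i ih =>
      rw [hs i] at ih
      simpa [hz0] using ih
  refine Complex.norm_le_of_sq_sub_mul_add_sq_eq_zero hτ hb (z := z) ?_
  apply mul_right_cancel₀ hv1
  rw [h1] at h0
  linear_combination h0

end Params

/-! ### Laplacian spectrum of a network -/

namespace Network

theorem laplacian_mulVec (G : Network) (x : Fin G.N → ℝ) (i : Fin G.N) :
    G.laplacian.mulVec x i = ∑ j, G.weight i j * (x i - x j) := by
  rw [laplacian, Matrix.sub_mulVec, Pi.sub_apply, Matrix.mulVec_diagonal]
  simp only [Matrix.mulVec, dotProduct, mul_sub, Finset.sum_sub_distrib, Finset.sum_mul]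

theorem sum_laplacian_mulVec (G : Network) (x : Fin G.N → ℝ) :
    ∑ i, G.laplacian.mulVec x i = 0 := by
  have h : ∑ i, G.laplacian.mulVec x i = -∑ i, G.laplacian.mulVec x i := by
    simp only [laplacian_mulVec]
    conv_lhs => rw [Finset.sum_comm]
    simp only [← Finset.sum_neg_distrib]
    refine Finset.sum_congr rfl fun i _ => Finset.sum_congr rfl fun j _ => ?_
    rw [G.weight_symm j i]
    ring
  linarith

theorem two_mul_dotProduct_laplacian_mulVec (G : Network) (x : Fin G.N → ℝ) :
    2 * (x ⬝ᵥ G.laplacian.mulVec x) = ∑ i, ∑ j, G.weight i j * (x i - x j) ^ 2 := by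
  have h1 : x ⬝ᵥ G.laplacian.mulVec x = ∑ i, ∑ j, G.weight i j * (x i * (x i - x j)) := by
    simp only [dotProduct, laplacian_mulVec, Finset.mul_sum]
    refine Finset.sum_congr rfl fun i _ => Finset.sum_congr rfl fun j _ => ?_
    ring
  have h2 : x ⬝ᵥ G.laplacian.mulVec x = ∑ i, ∑ j, G.weight i j * (x j * (x j - x i)) := by
    rw [h1, Finset.sum_comm]
    refine Finset.sum_congr rfl fun i _ => Finset.sum_congr rfl fun j _ => ?_
    rw [G.weight_symm j i]
  rw [two_mul]
  nth_rewrite 1 [h1]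
  rw [h2, ← Finset.sum_add_distrib]
  refine Finset.sum_congr rfl fun i _ => ?_
  rw [← Finset.sum_add_distrib]
  refine Finset.sum_congr rfl fun j _ => ?_
  ring

theorem weight_nonneg (G : Network) (i j : Fin G.N) : 0 ≤ G.weight i j := by
  by_cases h : G.graph.Adj i j
  · exact (G.weight_pos i j h).le
  · exact (G.weight_zero i j h).ge

/-- On a connected network the kernel of the Laplacian consists of the constant vectors. -/
theorem eq_of_laplacian_mulVec_eq_zero (G : Network) {x : Fin G.N → ℝ}
    (h : G.laplacian.mulVec x = 0) (i j : Fin G.N) : x i = x j := by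
  have h0 := G.two_mul_dotProduct_laplacian_mulVec x
  rw [h, dotProduct_zero, mul_zero, eq_comm] at h0
  have hnn : ∀ i j, 0 ≤ G.weight i j * (x i - x j) ^ 2 := fun i j =>
    mul_nonneg (G.weight_nonneg i j) (sq_nonneg _)
  have hadj : ∀ i j, G.graph.Adj i j → x i = x j := by
    intro i j hij
    have h1 := (Finset.sum_eq_zero_iff_of_nonneg
      fun i _ => Finset.sum_nonneg fun j _ => hnn i j).1 h0 i (Finset.mem_univ _)
    have h2 := (Finset.sum_eq_zero_iff_of_nonneg fun j _ => hnn i j).1 h1 j (Finset.mem_univ _)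
    have h3 := (mul_eq_zero.1 h2).resolve_left (G.weight_pos i j hij).ne'
    exact sub_eq_zero.1 (pow_eq_zero_iff two_ne_zero |>.1 h3)
  obtain ⟨w⟩ := G.connected.preconnected i j
  induction w with
  | nil => rfl
  | cons hij _ ih => exact (hadj _ _ hij).trans ih

theorem exists_eigenbasis (G : Network) :
    ∃ b : OrthonormalBasis (Fin G.N) ℝ (EuclideanSpace ℝ (Fin G.N)),
      ∀ i, G.laplacian.mulVec (b i) = G.eig i • (b i : Fin G.N → ℝ) := by
  let σ : Fin G.N ≃ Fin G.N := (Fin.revPerm.trans (finCongr (Fintype.card_fin G.N).symm)).trans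
    (Fintype.equivOfCardEq (Fintype.card_fin _))
  have hσ : ∀ i, G.eig i = G.laplacian_isHermitian.eigenvalues (σ i) := by
    intro i
    simp [eig, Matrix.IsHermitian.eigenvalues, σ, finCongr]
  refine ⟨G.laplacian_isHermitian.eigenvectorBasis.reindex σ.symm, fun i => ?_⟩
  rw [OrthonormalBasis.reindex_apply, hσ]
  exact G.laplacian_isHermitian.mulVec_eigenvectorBasis (σ i)

theorem monotone_eig (G : Network) : Monotone G.eig := by
  intro i j hij
  refine G.laplacian_isHermitian.eigenvalues₀_antitone ?_
  have h : (i : ℕ) ≤ j := hij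
  rw [Fin.le_def]
  simp
  omega

theorem eig_nonneg (G : Network) (i : Fin G.N) : 0 ≤ G.eig i := by
  obtain ⟨b, hb⟩ := G.exists_eigenbasis
  have h := G.two_mul_dotProduct_laplacian_mulVec (b i)
  have h1 : (b i : Fin G.N → ℝ) ⬝ᵥ (b i : Fin G.N → ℝ) = 1 := by
    have := b.inner_eq_one i
    rwa [EuclideanSpace.inner_eq_star_dotProduct] at this
  rw [hb, dotProduct_smul, h1] at h
  have : 0 ≤ ∑ k, ∑ j, G.weight k j * ((b i : Fin G.N → ℝ) k - (b i : Fin G.N → ℝ) j) ^ 2 :=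
    Finset.sum_nonneg fun k _ => Finset.sum_nonneg fun j _ =>
      mul_nonneg (G.weight_nonneg k j) (sq_nonneg _)
  simp at h
  linarith

/-- Zero is a simple Laplacian eigenvalue. -/
theorem eig_ne_zero (G : Network) {i : Fin G.N} (hi : 0 < (i : ℕ)) : G.eig i ≠ 0 := by
  intro h
  obtain ⟨b, hb⟩ := G.exists_eigenbasis
  set o : Fin G.N := ⟨0, by have := G.two_le; omega⟩ with ho
  have h0 : G.eig o = 0 := le_antisymm
    ((G.monotone_eig (by rw [Fin.le_def]; simp [ho])).trans h.le) (G.eig_nonneg o)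
  have hci := G.eq_of_laplacian_mulVec_eq_zero (x := b i) (by rw [hb, h, zero_smul])
  have hco := G.eq_of_laplacian_mulVec_eq_zero (x := b o) (by rw [hb, h0, zero_smul])
  have hne : o ≠ i := by
    intro h'
    simp [← h', ho] at hi
  have hin : inner ℝ (b o) (b i) = 0 := b.inner_eq_zero hne
  have hi1 : inner ℝ (b i) (b i) = 1 := b.inner_eq_one i
  have ho1 : inner ℝ (b o) (b o) = 1 := b.inner_eq_one o
  simp only [PiLp.inner_apply] at hin hi1 ho1
  simp only [fun k => hci k o, fun k => hco k o] at hin hi1 ho1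
  simp at hin hi1 ho1
  rcases hin with h | h | h
  · have := G.two_le
    omega
  all_goals simp [h] at hi1 ho1

/-- The complete graph on `N` agents with all weights `l / N`; its nonzero Laplacian eigenvalues
are all equal to `l`. -/
noncomputable def complete (N : ℕ) (hN : 2 ≤ N) (l : ℝ) (hl : 0 < l) : Network where
  N := N
  two_le := hN
  graph := ⊤
  weight := Matrix.of fun i j => if i = j then 0 else l / N
  weight_symm i j := by simp [eq_comm]
  weight_pos i j h := by
    have : (0 : ℝ) < N := by exact_mod_cast (by omega : 0 < N)
    have hij : i ≠ j := h
    simp only [Matrix.of_apply, hij, if_false]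
    positivity
  weight_zero i j h := by
    have hij : i = j := by simpa using h
    simp [hij]
  connected := by
    have : Nonempty (Fin N) := ⟨⟨0, by omega⟩⟩
    exact SimpleGraph.connected_top

theorem eig_eq_of_weight_eq (G : Network) {l : ℝ}
    (hw : ∀ k j, k ≠ j → G.weight k j = l / G.N) {i : Fin G.N} (hi : G.eig i ≠ 0) :
    G.eig i = l := by
  obtain ⟨b, hb⟩ := G.exists_eigenbasis
  have hN0 : (G.N : ℝ) ≠ 0 := by
    have := G.two_le
    exact_mod_cast (by omega : G.N ≠ 0)
  have hL : ∀ k, G.laplacian.mulVec (b i) k = l * b i k - l / G.N * ∑ j, b i j := by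
    intro k
    rw [laplacian_mulVec]
    have : ∀ j, G.weight k j * (b i k - b i j) = l / G.N * (b i k - b i j) := by
      intro j
      rcases eq_or_ne k j with rfl | h
      · simp
      · rw [hw k j h]
    simp only [this]
    rw [← Finset.mul_sum, Finset.sum_sub_distrib]
    simp
    field_simp
  have hs : ∑ j, b i j = 0 := by
    have := G.sum_laplacian_mulVec (b i)
    rw [hb] at this
    simp only [Pi.smul_apply, smul_eq_mul, ← Finset.mul_sum] at this
    exact (mul_eq_zero.1 this).resolve_left hi
  by_contra hne
  apply b.orthonormal.ne_zero i
  ext k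
  have := hL k
  rw [hs, hb, Pi.smul_apply, smul_eq_mul, mul_zero, sub_zero] at this
  by_contra h0
  exact hne (mul_right_cancel₀ h0 this)

theorem eig_complete (N : ℕ) (hN : 2 ≤ N) (l : ℝ) (hl : 0 < l)
    {i : Fin (complete N hN l hl).N} (hi : (complete N hN l hl).eig i ≠ 0) :
    (complete N hN l hl).eig i = l :=
  eig_eq_of_weight_eq _ (fun _ _ h => if_neg h) hi

end Network

/-! ### Consensus under one tap of node memory -/

/-- A perturbation `d` decaying like `τ ^ n` does not prevent the recursion `u (n + 1) = z u n + d n`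
with `‖z‖ ≤ τ < 1` from tending to zero, even in the resonant case. -/
theorem tendsto_zero_of_recursion {u d : ℕ → ℂ} {z : ℂ} {τ D : ℝ} (hτ0 : 0 ≤ τ) (hτ : τ < 1)
    (hz : ‖z‖ ≤ τ) (hd : ∀ n, ‖d n‖ ≤ D * τ ^ n) (hu : ∀ n, u (n + 1) = z * u n + d n) :
    Tendsto u atTop (𝓝 0) := by
  obtain ⟨s, hs, hs1⟩ := exists_between hτ
  have hs0 : 0 < s := hτ0.trans_lt hs
  have hD : 0 ≤ D := by simpa using (norm_nonneg _).trans (hd 0)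
  have hb : ∀ n : ℕ, ‖u n‖ ≤ ‖u 0‖ * s ^ n + D / s * (n * s ^ n) := by
    intro n
    induction n with
    | zero => simp
    | succ n ih =>
      have h1 : τ ^ n ≤ s ^ n := pow_le_pow_left₀ hτ0 hs.le n
      calc ‖u (n + 1)‖ ≤ ‖z‖ * ‖u n‖ + ‖d n‖ := by
            rw [hu, ← norm_mul]
            exact norm_add_le _ _
        _ ≤ s * (‖u 0‖ * s ^ n + D / s * (n * s ^ n)) + D * s ^ n := by
            refine add_le_add (mul_le_mul (hz.trans hs.le) ih (norm_nonneg _) hs0.le)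
              ((hd n).trans (mul_le_mul_of_nonneg_left h1 hD))
        _ = _ := by
            push_cast
            field_simp
            ring
  refine squeeze_zero_norm hb ?_
  have h1 := (tendsto_pow_atTop_nhds_zero_of_lt_one hs0.le hs1).const_mul ‖u 0‖
  have h2 := (tendsto_self_mul_const_pow_of_lt_one hs0.le hs1).const_mul (D / s)
  simpa using h1.add h2

theorem tendsto_zero_of_two_term_recursion {y : ℕ → ℝ} {b τ : ℝ} (hτ0 : 0 ≤ τ) (hτ : τ < 1)
    (hb : |b| ≤ 2 * τ) (hy : ∀ n, y (n + 2) = b * y (n + 1) - τ ^ 2 * y n) :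
    Tendsto y atTop (𝓝 0) := by
  obtain ⟨s, hs⟩ := IsAlgClosed.exists_pow_nat_eq ((b : ℂ) ^ 2 - 4 * (τ : ℂ) ^ 2) two_pos
  have hz₁ : ‖(b + s) / 2‖ ≤ τ :=
    Complex.norm_le_of_sq_sub_mul_add_sq_eq_zero hτ0 hb (by linear_combination hs / 4)
  have hz₂ : ‖(b - s) / 2‖ ≤ τ :=
    Complex.norm_le_of_sq_sub_mul_add_sq_eq_zero hτ0 hb (by linear_combination hs / 4)
  -- Factor the recursion through the two characteristic roots, one at a time.
  set d : ℕ → ℂ := fun n => y (n + 1) - (b + s) / 2 * y n with hd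
  have hd1 : ∀ n, d n = ((b - s) / 2) ^ n * d 0 := by
    intro n
    induction n with
    | zero => simp
    | succ n ih =>
      rw [pow_succ', mul_assoc, ← ih]
      simp only [hd, hy]
      push_cast
      linear_combination (-(y n : ℂ) / 4) * hs
  have h := tendsto_zero_of_recursion (u := fun n => (y n : ℂ)) (d := d) (D := ‖d 0‖) hτ0 hτ hz₁
    (fun n => by
      rw [hd1, norm_mul, norm_pow, mul_comm]
      gcongr) (fun n => by simp [hd])
  exact_mod_cast (Complex.continuous_re.tendsto 0).comp h

theorem eq_initial_of_increment_recursion {y : ℕ → ℝ} {t : ℝ} (h1 : y 1 = y 0)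
    (hy : ∀ n, y (n + 2) = y (n + 1) + t * (y (n + 1) - y n)) (n : ℕ) : y n = y 0 := by
  have h : ∀ n, y (n + 1) = y n := by
    intro n
    induction n with
    | zero => exact h1
    | succ n ih => rw [hy, ih]; ring
  induction n with
  | zero => rfl
  | succ n ih => rw [h, ih]

/-- The second-order iteration `X (n + 2) = X (n + 1) - e L X (n + 1) + τ² (X (n + 1) - X n)` started
from `X 1 = X 0` reaches average consensus if each nonzero Laplacian eigenvalue gives a mode with
characteristic roots of modulus at most `τ`: the nonzero modes decay, and the mean is conserved. -/
theorem Network.tendsto_average (G : Network) {X : ℕ → Fin G.N → ℝ} {e τ : ℝ} (hτ0 : 0 ≤ τ)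
    (hτ : τ < 1) (he : ∀ i, G.eig i ≠ 0 → |1 + τ ^ 2 - e * G.eig i| ≤ 2 * τ) (h1 : X 1 = X 0)
    (hX : ∀ n, X (n + 2) = X (n + 1) - e • G.laplacian.mulVec (X (n + 1))
      + τ ^ 2 • (X (n + 1) - X n)) (k : Fin G.N) :
    Tendsto (fun n => X n k) atTop (𝓝 (1 / G.N * ∑ j, X 0 j)) := by
  obtain ⟨b, hb⟩ := G.exists_eigenbasis
  set y : Fin G.N → ℕ → ℝ := fun i n => (b i : Fin G.N → ℝ) ⬝ᵥ X n with hydef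
  have hL : ∀ i x, (b i : Fin G.N → ℝ) ⬝ᵥ G.laplacian.mulVec x
      = G.eig i * ((b i : Fin G.N → ℝ) ⬝ᵥ x) := by
    intro i x
    have hT : G.laplacian.transpose = G.laplacian :=
      (Matrix.conjTranspose_eq_transpose_of_trivial _).symm.trans G.laplacian_isHermitian
    rw [Matrix.dotProduct_mulVec, ← Matrix.mulVec_transpose, hT, hb, smul_dotProduct, smul_eq_mul]
  have hy : ∀ i n, y i (n + 2) = (1 + τ ^ 2 - e * G.eig i) * y i (n + 1) - τ ^ 2 * y i n := by
    intro i n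
    simp only [hydef, hX, dotProduct_add, dotProduct_sub, dotProduct_smul, hL, smul_eq_mul]
    ring
  have hlim : ∀ i, ∃ c, Tendsto (y i) atTop (𝓝 c) ∧ G.eig i * c = 0 := by
    intro i
    by_cases h : G.eig i = 0
    · refine ⟨y i 0, ?_, by simp [h]⟩
      rw [show y i = fun _ => y i 0 from funext fun n =>
        eq_initial_of_increment_recursion (t := τ ^ 2) (by simp [hydef, h1])
          (fun n => by rw [hy, h]; ring) n]
      exact tendsto_const_nhds
    · exact ⟨0, tendsto_zero_of_two_term_recursion hτ0 hτ (he i h) (hy i), mul_zero _⟩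
  choose c hc hc0 using hlim
  set x : Fin G.N → ℝ := ∑ i, c i • (b i : Fin G.N → ℝ) with hx
  have hXy : ∀ n j, X n j = ∑ i, y i n * b i j := by
    intro n j
    have := congrFun (congrArg WithLp.ofLp (b.sum_repr' (WithLp.toLp 2 (X n)))) j
    simp only [EuclideanSpace.inner_eq_star_dotProduct] at this
    simp at this
    simp only [← this, hydef, dotProduct_comm]
  have hlimx : ∀ j, Tendsto (fun n => X n j) atTop (𝓝 (x j)) := by
    intro j
    simp only [hXy, hx, Finset.sum_apply, Pi.smul_apply, smul_eq_mul]
    exact tendsto_finsetSum _ fun i _ => (hc i).mul_const _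
  have hker : G.laplacian.mulVec x = 0 := by
    rw [hx, Matrix.mulVec_sum]
    refine Finset.sum_eq_zero fun i _ => ?_
    rw [Matrix.mulVec_smul, hb, smul_smul, mul_comm, hc0, zero_smul]
  have hsum : ∀ n, ∑ j, X n j = ∑ j, X 0 j := by
    refine eq_initial_of_increment_recursion (t := τ ^ 2) (by rw [h1]) fun n => ?_
    rw [hX]
    simp only [Pi.add_apply, Pi.sub_apply, Pi.smul_apply, smul_eq_mul, Finset.sum_add_distrib,
      Finset.sum_sub_distrib, ← Finset.mul_sum, sum_laplacian_mulVec]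
    ring
  have hsumx : ∑ j, x j = ∑ j, X 0 j := by
    refine tendsto_nhds_unique (tendsto_finsetSum _ fun j _ => hlimx j) ?_
    simp only [hsum]
    exact tendsto_const_nhds
  have hconst : x k = 1 / G.N * ∑ j, X 0 j := by
    have hN0 : (G.N : ℝ) ≠ 0 := by
      have := G.two_le
      exact_mod_cast (by omega : G.N ≠ 0)
    rw [← hsumx]
    simp only [fun j => G.eq_of_laplacian_mulVec_eq_zero hker j k]
    simp
    field_simp
  rw [← hconst]
  exact hlimx k

/-- The eigenvalue range `[α, β]` corresponds to traces `1 + τ² - ε₀ l` in `[-2τ, 2τ]`. -/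
theorem abs_oneTap_trace_le {α β l : ℝ} (hα : 0 < α) (hl : l ∈ Set.Icc α β) :
    |1 + ((√β - √α) / (√β + √α)) ^ 2 - 4 / (√β + √α) ^ 2 * l| ≤
      2 * ((√β - √α) / (√β + √α)) := by
  have hβ : 0 < β := hα.trans_le (hl.1.trans hl.2)
  have ha := Real.sqrt_pos.2 hα
  have hb := Real.sqrt_pos.2 hβ
  have h1 : √α ^ 2 ≤ l := by rw [Real.sq_sqrt hα.le]; exact hl.1
  have h2 : l ≤ √β ^ 2 := by rw [Real.sq_sqrt hβ.le]; exact hl.2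
  set a := √α
  set b := √β
  have hs : 0 < (b + a) ^ 2 := by positivity
  have e1 : 1 + ((b - a) / (b + a)) ^ 2 - 4 / (b + a) ^ 2 * l
      = ((b + a) ^ 2 + (b - a) ^ 2 - 4 * l) / (b + a) ^ 2 := by
    field_simp
  have e2 : 2 * ((b - a) / (b + a)) = (2 * (b - a) * (b + a)) / (b + a) ^ 2 := by
    field_simp
  rw [e1, e2, abs_div, abs_of_pos hs, div_le_div_iff_of_pos_right hs, abs_le]
  constructor <;> nlinarith

namespace Params

theorem control_eq (M : ℕ) (p : Params M) (G : Network) (x : ℤ → Fin G.N → ℝ) (k : ℤ)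
    (i : Fin G.N) : p.control G x k i =
      ∑ m : Fin (M + 1), (-p.ε m * G.laplacian.mulVec (x (k - (m : ℕ))) i
        + p.θ m * x (k - (m : ℕ)) i) := by
  rw [control, ← Finset.sum_add_distrib]
  refine Finset.sum_congr rfl fun m _ => ?_
  rw [Network.laplacian_mulVec, neg_mul, ← mul_neg, ← Finset.sum_neg_distrib]
  congr 2
  refine Finset.sum_congr rfl fun j _ => ?_
  ring

theorem reachesConsensus_oneTapParams {α β : ℝ} (hα : 0 < α) (hαβ : α ≤ β) {M : ℕ} (hM : 1 ≤ M)
    {G : Network} (hG : G ∈ uncertainNetworks α β) :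
    (oneTapParams α β M).ReachesConsensus G := by
  intro x hx i
  have ha := Real.sqrt_pos.2 hα
  have hb := Real.sqrt_pos.2 (hα.trans_le hαβ)
  have hab := Real.sqrt_le_sqrt hαβ
  have h0 : x (-1) = x 0 := hx.1 (-1) (by omega) (by omega)
  -- Start the count at time `-1`, so that the one-tap recursion holds from the first step on.
  have hX := G.tendsto_average (X := fun n => x ((n : ℤ) - 1)) (e := 4 / (√β + √α) ^ 2)
    (τ := (√β - √α) / (√β + √α)) (div_nonneg (by linarith) (by positivity))
    (by rw [div_lt_one (by positivity)]; linarith)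
    (fun i hi => abs_oneTap_trace_le hα (hG i hi)) (by simp [h0]) (fun n => by
      obtain ⟨K, rfl⟩ : ∃ K, M = K + 1 := ⟨M - 1, by omega⟩
      ext j
      have h := hx.2 n (by omega) j
      rw [control_eq, Fin.sum_univ_succ, Fin.sum_univ_succ] at h
      simp [oneTapParams] at h
      simp only [show ((n + 2 : ℕ) : ℤ) - 1 = n + 1 by push_cast; ring,
        show ((n + 1 : ℕ) : ℤ) - 1 = n by push_cast; ring]
      rw [h]
      simp
      ring) i
  simp only [Nat.cast_zero, zero_sub, h0] at hX
  have := hX.comp (tendsto_add_atTop_nat 1)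
  refine this.congr fun n => ?_
  simp

end Params

/-! ### Worst-case rates -/

namespace Params

variable {M : ℕ}

/-- Consensus on a single network forces `∑ θ_m = 0`: the all-ones state evolves by a scalar
recursion whose increments tend to `∑ θ_m` times the limit `1`. -/
theorem sum_θ_eq_zero_of_reachesConsensus {p : Params M} {G : Network}
    (h : p.ReachesConsensus G) : ∑ m, p.θ m = 0 := by
  let E : LinearRecurrence ℝ :=
    ⟨M + 1, fun i => (if i = Fin.last M then 1 else 0) + p.θ i.rev⟩
  set z : ℕ → ℝ := E.mkSol fun _ => 1 with hz
  have hinit : ∀ n ≤ M, z n = 1 := fun n hn =>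
    E.mkSol_eq_init (fun _ => 1) ⟨n, Nat.lt_succ_of_le hn⟩
  have hrec : ∀ k, z (k + M + 1) = z (k + M) + ∑ m : Fin (M + 1), p.θ m * z (k + M - m) := by
    intro k
    have h1 : z (k + (M + 1)) = ∑ i : Fin (M + 1),
        ((if i = Fin.last M then 1 else 0) + p.θ i.rev) * z (k + i) := E.is_sol_mkSol _ k
    rw [add_assoc, h1]
    simp only [add_mul, Finset.sum_add_distrib]
    congr 1
    · simp
    · rw [← Equiv.sum_comp Fin.revPerm]
      refine Finset.sum_congr rfl fun m _ => ?_
      rw [Fin.revPerm_apply, Fin.rev_rev]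
      congr 2
      rw [Fin.val_rev]
      omega
  have hnat : ∀ (k : ℕ) (m : Fin (M + 1)), ((k : ℤ) - (m : ℕ) + M).toNat = k + M - m := by
    intro k m
    have := m.isLt
    omega
  have htraj : p.IsTrajectory G fun k _ => z ((k + M).toNat) := by
    constructor
    · intro k hk hk0
      ext i
      change z _ = z _
      rw [hinit _ (by omega), hinit _ (by omega)]
    · intro k hk i
      lift k to ℕ using hk
      rw [control_eq]
      have hL : ∀ a : ℝ, G.laplacian.mulVec (fun _ => a) i = 0 := fun a => by
        simp [Network.laplacian_mulVec]
      simp only [hL, mul_zero, zero_add, hnat]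
      rw [show ((k : ℤ) + 1 + M).toNat = k + M + 1 by omega,
        show ((k : ℤ) + M).toNat = k + M by omega]
      exact hrec k
  have hN : (G.N : ℝ) ≠ 0 := by
    have := G.two_le
    exact_mod_cast (by omega : G.N ≠ 0)
  have hlim := h _ htraj ⟨0, by have := G.two_le; omega⟩
  have hz0 : z ((0 + (M : ℤ)).toNat) = 1 := hinit _ (by omega)
  simp only [hz0, Finset.sum_const, Finset.card_univ, Fintype.card_fin, nsmul_eq_mul, mul_one,
    one_div, inv_mul_cancel₀ hN] at hlim
  have hlim' : Tendsto z atTop (𝓝 1) := by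
    rw [← tendsto_add_atTop_iff_nat M]
    refine hlim.congr fun n => ?_
    congr 1
  have h1 : Tendsto (fun k => z (k + M + 1) - z (k + M)) atTop (𝓝 (1 - 1)) :=
    ((tendsto_add_atTop_iff_nat (M + 1)).2 hlim').sub ((tendsto_add_atTop_iff_nat M).2 hlim')
  have h2 : Tendsto (fun k => ∑ m : Fin (M + 1), p.θ m * z (k + M - m)) atTop
      (𝓝 (∑ m : Fin (M + 1), p.θ m * 1)) := by
    refine tendsto_finsetSum _ fun m _ => Tendsto.const_mul _ ?_
    refine ((tendsto_add_atTop_iff_nat (M - m)).2 hlim').congr fun k => ?_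
    have := m.isLt
    congr 1
    omega
  simp only [hrec, add_sub_cancel_left] at h1
  simpa using tendsto_nhds_unique h2 h1

/-- On a class containing all weighted complete graphs with spectrum `{0, l}`, `l ∈ [α, β]`, the
worst-case rate dominates the spectral radius at every `l ∈ [α, β]`. -/
theorem iSup_rho_le_worstCaseRate (p : Params M) {α β : ℝ} {𝒢 : Set Network}
    (h𝒢 : ∀ l ∈ Set.Icc α β, ∃ G ∈ 𝒢, ∀ i, G.eig i ≠ 0 → G.eig i = l) :
    ⨆ l ∈ Set.Icc α β, p.rho l ≤ p.worstCaseRate 𝒢 := by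
  refine iSup₂_le fun l hl => ?_
  obtain ⟨G, hG, hGl⟩ := h𝒢 l hl
  have h1 : p.rho l ≤ p.rate G := by
    have hi : 0 < ((⟨1, G.two_le⟩ : Fin G.N) : ℕ) := Nat.one_pos
    rw [← hGl _ (G.eig_ne_zero hi)]
    exact le_iSup₂ (f := fun (i : Fin G.N) (_ : 0 < (i : ℕ)) => p.rho (G.eig i)) _ hi
  exact h1.trans (le_iSup₂ (f := fun G (_ : G ∈ 𝒢) => p.rate G) G hG)

theorem rho_oneTapParams_le {α β : ℝ} (hα : 0 < α) (hM : 1 ≤ M) {l : ℝ}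
    (hl : l ∈ Set.Icc α β) :
    (oneTapParams α β M).rho l ≤ ENNReal.ofReal ((√β - √α) / (√β + √α)) := by
  refine rho_le_of_two_term hM _
    (div_nonneg (sub_nonneg.2 (Real.sqrt_le_sqrt (hl.1.trans hl.2))) (by positivity))
    (abs_oneTap_trace_le hα hl) fun j => ?_
  rcases eq_or_ne j 0 with rfl | hj
  · simp [oneTapParams]
  · have hj' : (j : ℕ) ≠ 0 := fun h => hj (Fin.ext h)
    simp [oneTapParams, hj, hj']

theorem worstCaseRate_oneTapParams_le {α β : ℝ} (hα : 0 < α) (hM : 1 ≤ M) {𝒢 : Set Network}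
    (h𝒢 : 𝒢 ⊆ uncertainNetworks α β) :
    (oneTapParams α β M).worstCaseRate 𝒢 ≤ ENNReal.ofReal ((√β - √α) / (√β + √α)) :=
  iSup₂_le fun G hG => iSup₂_le fun i hi =>
    rho_oneTapParams_le hα hM (h𝒢 hG i (G.eig_ne_zero hi))

theorem sum_θ_oneTapParams (α β : ℝ) (hM : 1 ≤ M) : ∑ m, (oneTapParams α β M).θ m = 0 := by
  obtain ⟨K, rfl⟩ : ∃ K, M = K + 1 := ⟨M - 1, by omega⟩
  rw [Fin.sum_univ_succ, Fin.sum_univ_succ]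
  simp [oneTapParams]

theorem admissible_oneTapParams {α β : ℝ} (hα : 0 < α) (hαβ : α ≤ β) (hM : 1 ≤ M)
    {𝒢 : Set Network} (h𝒢 : 𝒢 ⊆ uncertainNetworks α β) :
    (oneTapParams α β M).Admissible 𝒢 := by
  refine ⟨fun m => ?_, fun G hG => reachesConsensus_oneTapParams hα hαβ hM (h𝒢 hG)⟩
  simp only [oneTapParams]
  split_ifs <;> positivity

theorem ofReal_le_worstCaseRate (p : Params M) (hθ : ∑ m, p.θ m = 0) {α β : ℝ} (hα : 0 < α)
    (hαβ : α ≤ β) {𝒢 : Set Network}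
    (h𝒢 : ∀ l ∈ Set.Icc α β, ∃ G ∈ 𝒢, ∀ i, G.eig i ≠ 0 → G.eig i = l) :
    ENNReal.ofReal ((√β - √α) / (√β + √α)) ≤ p.worstCaseRate 𝒢 :=
  (p.le_iSup_rho hθ hα hαβ).trans (p.iSup_rho_le_worstCaseRate h𝒢)

end Params

theorem optimalWorstCaseRate_eq {α β : ℝ} (hα : 0 < α) (hαβ : α ≤ β) {M : ℕ} (hM : 1 ≤ M)
    {𝒢 : Set Network} (hsub : 𝒢 ⊆ uncertainNetworks α β)
    (h𝒢 : ∀ l ∈ Set.Icc α β, ∃ G ∈ 𝒢, ∀ i, G.eig i ≠ 0 → G.eig i = l) :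
    optimalWorstCaseRate M 𝒢 = ENNReal.ofReal ((√β - √α) / (√β + √α)) := by
  refine le_antisymm ?_ ?_
  · exact (iInf₂_le (f := fun (p : Params M) (_ : p.Admissible 𝒢) => p.worstCaseRate 𝒢) _
      (Params.admissible_oneTapParams hα hαβ hM hsub)).trans
      (Params.worstCaseRate_oneTapParams_le hα hM hsub)
  · refine le_iInf₂ fun p hp => ?_
    obtain ⟨G, hG, -⟩ := h𝒢 α ⟨le_rfl, hαβ⟩
    exact p.ofReal_le_worstCaseRate
      (Params.sum_θ_eq_zero_of_reachesConsensus (hp.2 G hG)) hα hαβ h𝒢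

theorem Network.complete_mem_uncertainNetworks {α β l : ℝ} (hα : 0 < α) (hl : l ∈ Set.Icc α β)
    {N : ℕ} (hN : 2 ≤ N) :
    complete N hN l (hα.trans_le hl.1) ∈ uncertainNetworks α β := fun i hi => by
  rwa [eig_complete N hN l _ hi]

theorem theorem2 (α β : ℝ) (hα : 0 < α) (hαβ : α ≤ β) (M : ℕ) (hM : 1 ≤ M)
    (𝒢 : Set Network)
    (h𝒢 : 𝒢 = uncertainNetworks α β ∨
      ∃ N : ℕ, 2 ≤ N ∧ 𝒢 = {G | G ∈ uncertainNetworks α β ∧ G.N = N}) :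
    optimalWorstCaseRate M 𝒢 = ENNReal.ofReal ((√β - √α) / (√β + √α)) ∧
    (oneTapParams α β M).Admissible 𝒢 ∧
    (oneTapParams α β M).worstCaseRate 𝒢 = ENNReal.ofReal ((√β - √α) / (√β + √α)) ∧
    (∀ p : Params M, ∑ m, p.θ m = 0 →
      ENNReal.ofReal ((√β - √α) / (√β + √α)) ≤ p.worstCaseRate 𝒢) ∧
    optimalWorstCaseRate M 𝒢 = optimalWorstCaseRate 1 𝒢 := by
  have hsub : 𝒢 ⊆ uncertainNetworks α β := by
    rcases h𝒢 with rfl | ⟨N, -, rfl⟩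
    · exact subset_rfl
    · exact fun G hG => hG.1
  have hex : ∀ l ∈ Set.Icc α β, ∃ G ∈ 𝒢, ∀ i, G.eig i ≠ 0 → G.eig i = l := by
    intro l hl
    rcases h𝒢 with rfl | ⟨N, hN, rfl⟩
    · exact ⟨_, Network.complete_mem_uncertainNetworks hα hl le_rfl,
        fun _ hi => Network.eig_complete _ _ _ _ hi⟩
    · exact ⟨_, ⟨Network.complete_mem_uncertainNetworks hα hl hN, rfl⟩,
        fun _ hi => Network.eig_complete _ _ _ _ hi⟩
  have hlow : ∀ p : Params M, ∑ m, p.θ m = 0 →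
      ENNReal.ofReal ((√β - √α) / (√β + √α)) ≤ p.worstCaseRate 𝒢 :=
    fun p hp => p.ofReal_le_worstCaseRate hp hα hαβ hex
  refine ⟨optimalWorstCaseRate_eq hα hαβ hM hsub hex,
    Params.admissible_oneTapParams hα hαβ hM hsub,
    le_antisymm (Params.worstCaseRate_oneTapParams_le hα hM hsub)
      (hlow _ (Params.sum_θ_oneTapParams α β hM)), hlow, ?_⟩
  rw [optimalWorstCaseRate_eq hα hαβ hM hsub hex, optimalWorstCaseRate_eq hα hαβ le_rfl hsub hex]
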